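/- Let $\mathbb{T}^3=[-\pi,\pi]^3$ be the torus. For $u\in (L^2(\mathbb{T}^3))^3$ (complex valued) let $\hat u_j=(2\pi)^{-3}\int_{\mathbb{T}^3}u(x)e^{-ij\cdot x}\,dx\in\mathbb{C}^3$, $j\in\mathbb{Z}^3$, be its Fourier coefficients and $\|u\|^2=\sum_j|\hat u_j|^2$. For $j\neq0$ let $P_\sigma^j=I-|j|^{-2}\,j\otimes j$, let $P_\sigma u=\sum_{j\ne0}P^j_\sigma\hat u_j e^{ij\cdot x}$ be the Leray projector (also for formal Fourier series), and let $H=P_\sigma (L^2(\mathbb{T}^3))^3$ be the space of divergence-free fields with zero mean. Let $A=-P_\sigma\Delta$ be the Stokes operator, so that $A^s$ is the Fourier multiplier $|j|^{2s}$, let $H^s=D(A^{s/2})$, and let $B(a,b)=P_\sigma((a\cdot\nabla)b)$. Let $\lambda_1\le\lambda_2\le\cdots$ be the eigenvalues of $A$ on $H$ repeated with multiplicity, and for $N\ge1$ and $0<k<\lambda_N$ let $\mathcal{R}_{k,N}$ be the spectral projector of $A$ onto the eigenvalues in $[\lambda_N-k,\lambda_N+k]$, that is, $\mathcal{R}_{k,N}a=\sum_{\lambda_N-k\le|j|^2\le\lambda_N+k}P_\sigma^j\hat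 a_je^{ij\cdot x}$ for every Fourier series $a$. Let $\nu>0$, $f\in H$, and let $v\in H^{5/4}$ be a stationary solution, $\nu A^{5/4}v+B(v,v)=f$. Let $\eta\in C_c^\infty(\mathbb{C};\mathbb{C})$ (smooth in the real sense) satisfy $\eta(\xi)=\xi$ for $|\xi|\le1$ and $|\eta|\le2$, and put $\vec\eta(\xi)=(\eta(\xi_1),\eta(\xi_2),\eta(\xi_3))$ for $\xi\in\mathbb{C}^3$. Let $\varrho>0$, and for $w\in H$ set $$W(w)=\sum_{j\in\mathbb{Z}^3\setminus\{0\}}\frac{\varrho}{|j|^{9/2}}\,P_\sigma^j\,\vec\eta\!\left(\frac{|j|^{9/2}\hat w_j}{\varrho}\right)e^{ij\cdot x},\qquad F_3(W(w))=A^{-1/4}\big(B(W(w),W(w))+B(v,W(w))+B(W(w),v)\big).$$ Let $W'(w)z=\lim_{h\to0,\,h\in\mathbb{R}}\big(W(w+hz)-W(w)\big)/h$ be the Gateaux derivative of $W$, and let $$F_3'(W(w))z=A^{-1/4}\Big(B\big(W'(w)z,\,W(w)+v\big)+B\big(W(w)+v,\,W'(w)z\big)\Big)$$ be the corresponding derivative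 of $w\mapsto F_3(W(w))$, understood as a Fourier series. Then for every $\delta>0$ there exist $N\ge1$ and $k$ with $0<k<\lambda_N$ such that the spatial averaging condition $$\|\mathcal{R}_{k,N}F_3'(W(w))\mathcal{R}_{k,N}z\|\le\delta\|z\|\qquad\text{for all } w,z\in H$$ holds. -/

import Mathlib

open MeasureTheory
open scoped ContDiff

noncomputable section

namespace HyperNS

/-- The torus `𝕋³ = [-π, π]³` with opposite faces identified, parametrised by `(ℝ/ℤ)³` through
`x = 2π t`; the character `e^{i j · x}` is `UnitAddTorus.mFourier j`. -/
abbrev Torus : Type := UnitAddTorus (Fin 3)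

/-- Normalised Lebesgue measure `(2π)⁻³ dx` on the torus. -/
abbrev torusMeasure : Measure Torus := Measure.pi fun _ : Fin 3 => AddCircle.haarAddCircle

/-- `L²(𝕋³)`, complex valued. -/
abbrev ScalarL2 : Type := Lp ℂ 2 torusMeasure

/-- `(L²(𝕋³))³`, with `‖u‖² = ‖u¹‖² + ‖u²‖² + ‖u³‖²`. -/
abbrev VecL2 : Type := PiLp 2 fun _ : Fin 3 => ScalarL2

/-- Frequencies `j ∈ ℤ³`. -/
abbrev Freq : Type := Fin 3 → ℤ

/-- `ℂ³` with its Euclidean norm. -/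
abbrev Vec : Type := EuclideanSpace ℂ (Fin 3)

/-- Formal vector valued Fourier series `∑ⱼ aⱼ e^{i j · x}`, given by their coefficients. They
contain the distributions on the torus, hence all the spaces `H^s`, `s ∈ ℝ`. -/
abbrev FourierSeries : Type := Freq → Vec

/-- `|j|² = j₁² + j₂² + j₃²`. -/
def normSq (j : Freq) : ℤ := ∑ i, j i ^ 2

/-- `|j|`. -/
def absFreq (j : Freq) : ℝ := Real.sqrt (normSq j)

/-- The Fourier coefficients `û_j = (2π)⁻³ ∫ u(x) e^{-i j · x} dx ∈ ℂ³` of `u ∈ (L²(𝕋³))³`. -/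
def coeff (u : VecL2) : FourierSeries := fun j =>
  WithLp.toLp 2 fun i => UnitAddTorus.mFourierCoeff (u i : Torus → ℂ) j

/-- The vector field `x ↦ c e^{i j · x}`. -/
def mode (j : Freq) (c : Vec) : VecL2 :=
  WithLp.toLp 2 fun i => c i • (UnitAddTorus.mFourierLp 2 j : ScalarL2)

/-- The matrix of the Leray projector at the frequency `j`. -/
def lerayMatrix (j : Freq) : Matrix (Fin 3) (Fin 3) ℂ :=
  ((normSq j : ℂ))⁻¹ •
    !![(j 1 : ℂ) ^ 2 + (j 2 : ℂ) ^ 2, -((j 0 : ℂ) * j 1), -((j 0 : ℂ) * j 2);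
       -((j 0 : ℂ) * j 1), (j 0 : ℂ) ^ 2 + (j 2 : ℂ) ^ 2, -((j 1 : ℂ) * j 2);
       -((j 0 : ℂ) * j 2), -((j 1 : ℂ) * j 2), (j 0 : ℂ) ^ 2 + (j 1 : ℂ) ^ 2]

/-- The Leray projector `P_σ^j` acting on `ℂ³`; `P_σ^0 = 0`, since `P_σ` removes the mean. -/
def leray (j : Freq) (c : Vec) : Vec :=
  WithLp.toLp 2 ((lerayMatrix j).mulVec c.ofLp)

/-- The phase space `H = P_σ (L²(𝕋³))³` of divergence free fields of zero mean. -/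
def H : Set VecL2 := {u | ∀ j, leray j (coeff u j) = coeff u j}

/-- `H^s = D(A^{s/2}) ⊆ H`, for `s ≥ 0`. -/
def Sobolev (s : ℝ) : Set VecL2 :=
  {u | u ∈ H ∧ Summable fun j : Freq => absFreq j ^ (2 * s) * ‖coeff u j‖ ^ 2}

/-- The power `A^s` of the Stokes operator `A = -P_σ Δ`, on divergence free series of zero mean:
the Fourier multiplier with symbol `|j|^{2s}`. -/
def stokesPow (s : ℝ) (a : FourierSeries) : FourierSeries := fun j =>
  absFreq j ^ (2 * s) • a j

/-- The bilinear form `B(a, b) = P_σ ((a · ∇) b)`, in Fourier coefficients: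
`((a · ∇) b)^_j = ∑_ℓ i (â_{j-ℓ} · ℓ) b̂_ℓ`, where `p · ℓ = ∑ₘ pₘ ℓₘ`. -/
def bilin (a b : FourierSeries) : FourierSeries := fun j =>
  leray j (∑' l : Freq, (Complex.I * ∑ m, a (j - l) m * (l m : ℂ)) • b l)

/-- `v` is a stationary solution with forcing `f`: `v ∈ H^{5/4}` and `ν A^{5/4} v + B(v, v) = f`
(in the sense of distributions, that is, coefficient by coefficient). -/
def IsStationarySolution (ν : ℝ) (f v : VecL2) : Prop :=
  v ∈ Sobolev (5 / 4) ∧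
    ∀ j, ν • stokesPow (5 / 4) (coeff v) j + bilin (coeff v) (coeff v) j = coeff f j

/-- The scalar cut-off function: `η ∈ C_c^∞(ℂ)` in the real sense, `η(ξ) = ξ` for `|ξ| ≤ 1` and
`|η| ≤ 2`. -/
def IsCutoff (η : ℂ → ℂ) : Prop :=
  ContDiff ℝ ∞ η ∧ HasCompactSupport η ∧ (∀ ξ, ‖ξ‖ ≤ 1 → η ξ = ξ) ∧ ∀ ξ, ‖η ξ‖ ≤ 2

/-- The truncation operator
`W(w) = ∑_{j ≠ 0} (ϱ / |j|^{9/2}) P_σ^j η⃗(|j|^{9/2} ŵ_j / ϱ) e^{i j · x}`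
(sum in `(L²(𝕋³))³`), where `η⃗` applies `η` to each of the three components. -/
def trunc (η : ℂ → ℂ) (ϱ : ℝ) (w : VecL2) : VecL2 :=
  ∑' j : {j : Freq // j ≠ 0},
    mode j ((ϱ / absFreq j ^ (9 / 2 : ℝ)) •
      leray j (WithLp.toLp 2 fun i => η ((absFreq j ^ (9 / 2 : ℝ) / ϱ : ℝ) • coeff w j i)))

/-- The Gateaux derivative `W'(w) z = lim_{h → 0} (W(w + h z) - W(w)) / h`, with `h` real. -/
def truncDeriv (η : ℂ → ℂ) (ϱ : ℝ) (w z : VecL2) : VecL2 :=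
  lineDeriv ℝ (trunc η ϱ) w z

/-- The derivative of `w ↦ F₃(W(w)) = A^{-1/4} (B(W(w), W(w)) + B(v, W(w)) + B(W(w), v))`:
`F₃'(W(w)) z = A^{-1/4} (B(W'(w) z, W(w) + v) + B(W(w) + v, W'(w) z))`. -/
def nonlinDeriv (η : ℂ → ℂ) (ϱ : ℝ) (v w z : VecL2) : FourierSeries :=
  stokesPow (-(1 / 4))
    (bilin (coeff (truncDeriv η ϱ w z)) (coeff (trunc η ϱ w + v)) +
      bilin (coeff (trunc η ϱ w + v)) (coeff (truncDeriv η ϱ w z)))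

/-- The number of eigenvalues `≤ m` of the Stokes operator `A` on `H`, with multiplicity. The
eigenfunctions are `c e^{i j · x}` with `j ≠ 0` and `c · j = 0`, of eigenvalue `|j|²`; each `j`
carries a two dimensional space of amplitudes `c`. -/
def stokesCount (m : ℕ) : ℕ := 2 * Nat.card {j : Freq // j ≠ 0 ∧ normSq j ≤ m}

/-- The eigenvalues `λ₁ ≤ λ₂ ≤ ⋯` of the Stokes operator, repeated with multiplicity. -/
def stokesEigenvalue (N : ℕ) : ℕ := sInf {m : ℕ | N ≤ stokesCount m}

/-- The spectral projector `R_{k,N}` of `A` onto the eigenvalues in `[λ_N - k, λ_N + k]`. It maps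
any Fourier series to a (divergence free) trigonometric polynomial. -/
def specProj (k : ℝ) (N : ℕ) (a : FourierSeries) : VecL2 :=
  ∑' j : {j : Freq // j ≠ 0 ∧ (stokesEigenvalue N : ℝ) - k ≤ normSq j ∧
      (normSq j : ℝ) ≤ stokesEigenvalue N + k},
    mode j (leray j (a j))

end HyperNS

end

/-! Take `λ_N = 4 ^ m` and `k = 1/2`. The spectral window then contains only the sphere `|j|² = 4 ^
m`. A sum of three squares divisible by `4` has all its terms even, so by descent this sphere
consists of the points `2 ^ m • e` with `|e| = 1`: their number is bounded in `m` and their mutual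
distances are at least `2 ^ m`.

The compressed operator is thus a matrix of bounded size, and it suffices to bound its entries.
`W'(w)` acts frequency by frequency and is bounded uniformly in `w`. The entry from `l` to `j`
involves `W(w) + v` only at `j - l`. It vanishes for `j = l`, because the mean is zero; otherwise
the coefficient is `O(2 ^ (-5m/4))`. The gradient costs `2 ^ m` and `A^{-1/4}` gains `2 ^ (-m/2)`,
so every entry is `O(2 ^ (-3m/4))` (`exists_norm_nonlinDeriv_le`), which is small for large `m`. -/

noncomputable section

namespace HyperNS

/-! ### Fourier coefficients and single modes. -/

/-- The coordinates of `coeff u j` are inner products with the Fourier monomials. -/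
theorem coeff_apply_eq_inner (u : VecL2) (j : Freq) (i : Fin 3) :
    coeff u j i = inner ℂ (UnitAddTorus.mFourierLp 2 j : ScalarL2) (u i) := by
  have h := UnitAddTorus.mFourierBasis_repr (d := Fin 3) (u i) j
  rw [HilbertBasis.repr_apply_apply, UnitAddTorus.coe_mFourierBasis] at h
  exact h.symm

theorem norm_mFourierLp (j : Freq) : ‖(UnitAddTorus.mFourierLp 2 j : ScalarL2)‖ = 1 :=
  (UnitAddTorus.orthonormal_mFourier (d := Fin 3)).1 j

theorem inner_mFourierLp (j l : Freq) :
    inner ℂ (UnitAddTorus.mFourierLp 2 j : ScalarL2) (UnitAddTorus.mFourierLp 2 l : ScalarL2)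
      = if j = l then 1 else 0 :=
  orthonormal_iff_ite.mp (UnitAddTorus.orthonormal_mFourier (d := Fin 3)) j l

theorem norm_coeff_le (u : VecL2) (j : Freq) : ‖coeff u j‖ ≤ ‖u‖ := by
  rw [EuclideanSpace.norm_eq, PiLp.norm_eq_of_L2]
  refine Real.sqrt_le_sqrt (Finset.sum_le_sum fun i _ => ?_)
  rw [coeff_apply_eq_inner]
  gcongr
  simpa [norm_mFourierLp] using
    norm_inner_le_norm (𝕜 := ℂ) (UnitAddTorus.mFourierLp 2 j : ScalarL2) (u i)

/-- The Fourier coefficient at `j` as a continuous linear map. -/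
def coeffCLM (j : Freq) : VecL2 →L[ℂ] Vec :=
  LinearMap.mkContinuous
    { toFun := fun u => coeff u j
      map_add' := fun u v => by ext i; simp [coeff_apply_eq_inner, inner_add_right]
      map_smul' := fun c u => by ext i; simp [coeff_apply_eq_inner, inner_smul_right] }
    1 fun u => by simpa using norm_coeff_le u j

theorem coeffCLM_apply (j : Freq) (u : VecL2) : coeffCLM j u = coeff u j := rfl

theorem coeff_add (u v : VecL2) (j : Freq) : coeff (u + v) j = coeff u j + coeff v j :=
  (coeffCLM j).map_add u v

theorem coeff_real_smul (t : ℝ) (u : VecL2) (j : Freq) : coeff (t • u) j = t • coeff u j :=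
  ((coeffCLM j).restrictScalars ℝ).map_smul t u

theorem norm_mode (j : Freq) (c : Vec) : ‖mode j c‖ = ‖c‖ := by
  rw [EuclideanSpace.norm_eq, PiLp.norm_eq_of_L2]
  have h (i : Fin 3) : ‖mode j c i‖ = ‖c i‖ :=
    (norm_smul (c i) (UnitAddTorus.mFourierLp 2 j : ScalarL2)).trans
      (by rw [norm_mFourierLp, mul_one])
  simp only [h]

theorem coeff_mode (l j : Freq) (c : Vec) : coeff (mode l c) j = if j = l then c else 0 := by
  ext i
  rw [coeff_apply_eq_inner]
  simp only [mode, inner_smul_right, inner_mFourierLp]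
  split_ifs <;> simp

/-- `c ↦ c e^{i j · x}` as a continuous linear map. -/
def modeCLM (j : Freq) : Vec →L[ℂ] VecL2 :=
  LinearMap.mkContinuous
    { toFun := mode j
      map_add' := fun u v => by ext1 i; simp [mode, add_smul]
      map_smul' := fun c u => by ext1 i; simp [mode, mul_smul] }
    1 fun u => by simp [norm_mode]

theorem modeCLM_apply (j : Freq) (c : Vec) : modeCLM j c = mode j c := rfl

/-! ### Lattice frequencies and the Leray projector. -/

theorem normSq_eq (j : Freq) : normSq j = j 0 ^ 2 + j 1 ^ 2 + j 2 ^ 2 := by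
  simp [normSq, Fin.sum_univ_three]

theorem normSq_nonneg (j : Freq) : 0 ≤ normSq j := Finset.sum_nonneg fun _ _ => sq_nonneg _

theorem normSq_eq_zero {j : Freq} : normSq j = 0 ↔ j = 0 := by
  rw [normSq, Finset.sum_eq_zero_iff_of_nonneg fun _ _ => sq_nonneg _]
  simp [funext_iff]

theorem normSq_pos {j : Freq} (hj : j ≠ 0) : 0 < normSq j :=
  (normSq_nonneg j).lt_of_ne' (mt normSq_eq_zero.mp hj)

theorem absFreq_nonneg (j : Freq) : 0 ≤ absFreq j := Real.sqrt_nonneg _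

theorem one_le_absFreq {j : Freq} (hj : j ≠ 0) : 1 ≤ absFreq j :=
  Real.one_le_sqrt.mpr (by exact_mod_cast normSq_pos hj)

theorem absFreq_pos {j : Freq} (hj : j ≠ 0) : 0 < absFreq j :=
  zero_lt_one.trans_le (one_le_absFreq hj)

theorem abs_apply_le_absFreq (j : Freq) (i : Fin 3) : |(j i : ℝ)| ≤ absFreq j := by
  refine Real.abs_le_sqrt ?_
  have := Finset.single_le_sum (f := fun i => j i ^ 2) (fun i _ => sq_nonneg _) (Finset.mem_univ i)
  exact_mod_cast this

theorem lerayMatrix_zero : lerayMatrix 0 = 0 := by simp [lerayMatrix, normSq]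

theorem lerayMatrix_isHermitian (j : Freq) : (lerayMatrix j).IsHermitian := by
  ext a b
  fin_cases a <;> fin_cases b <;> simp [lerayMatrix]

theorem lerayMatrix_mul_self (j : Freq) : lerayMatrix j * lerayMatrix j = lerayMatrix j := by
  rcases eq_or_ne j 0 with rfl | hj
  · simp [lerayMatrix_zero]
  · have h : ((normSq j : ℂ)) ≠ 0 := by exact_mod_cast (normSq_pos hj).ne'
    have h' : (normSq j : ℂ) = (j 0 : ℂ) ^ 2 + (j 1 : ℂ) ^ 2 + (j 2 : ℂ) ^ 2 := by
      rw [normSq_eq]; push_cast; rfl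
    rw [lerayMatrix, Matrix.smul_mul, Matrix.mul_smul]
    congr 1
    rw [inv_smul_eq_iff₀ h, h']
    ext a b
    fin_cases a <;> fin_cases b <;>
      simp [Matrix.mul_apply, Fin.sum_univ_three] <;> ring

/-- The Leray projector at the frequency `j` as a continuous linear map. -/
def lerayCLM (j : Freq) : Vec →L[ℂ] Vec :=
  LinearMap.toContinuousLinearMap (Matrix.toEuclideanLin (lerayMatrix j))

theorem leray_zero_freq (c : Vec) : leray 0 c = 0 := by
  simp [leray, lerayMatrix_zero]

theorem leray_leray (j : Freq) (c : Vec) : leray j (leray j c) = leray j c := by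
  simp only [leray, Matrix.mulVec_mulVec, lerayMatrix_mul_self]

/-- The matrix is Hermitian and idempotent, so `‖Pc‖² = ⟪c, Pc⟫`, and Cauchy–Schwarz concludes. -/
theorem norm_leray_le (j : Freq) (c : Vec) : ‖leray j c‖ ≤ ‖c‖ := by
  have hsymm := Matrix.isSymmetric_toEuclideanLin_iff.mpr (lerayMatrix_isHermitian j)
  have h : inner ℂ (leray j c) (leray j c) = inner ℂ c (leray j c) := by
    have := hsymm c (leray j c)
    change inner ℂ (leray j c) (leray j c) = inner ℂ c (leray j (leray j c)) at this
    rwa [leray_leray] at this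
  have h2 : ‖leray j c‖ * ‖leray j c‖ ≤ ‖c‖ * ‖leray j c‖ := by
    rw [← inner_self_eq_norm_mul_norm (𝕜 := ℂ), h]
    exact (RCLike.re_le_norm _).trans (norm_inner_le_norm _ _)
  rcases (norm_nonneg (leray j c)).eq_or_lt with h0 | h0
  · rw [← h0]; exact norm_nonneg _
  · exact le_of_mul_le_mul_right h2 h0

theorem norm_le_of_forall_apply_le {x : Vec} {M : ℝ} (h : ∀ i, ‖x i‖ ≤ M) : ‖x‖ ≤ 3 * M := by
  have hM : 0 ≤ M := (norm_nonneg _).trans (h 0)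
  rw [EuclideanSpace.norm_eq]
  refine Real.sqrt_le_iff.mpr ⟨by positivity, ?_⟩
  calc ∑ i, ‖x i‖ ^ 2 ≤ ∑ _i : Fin 3, M ^ 2 := by gcongr; exact h _
    _ ≤ (3 * M) ^ 2 := by simp; nlinarith [sq_nonneg M]

theorem norm_apply_le (x : Vec) (i : Fin 3) : ‖x i‖ ≤ ‖x‖ := PiLp.norm_apply_le x i

/-- `∑ |j|^r` over `ℤ³` converges for `r < -3`. -/
theorem summable_absFreq_rpow {r : ℝ} (hr : r < -3) : Summable fun j : Freq => absFreq j ^ r := by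
  -- Realise `ℤ³` as the rank-three lattice spanned by the standard basis, where the criterion for
  -- lattice sums applies.
  let b := (EuclideanSpace.basisFun (Fin 3) ℝ).toBasis
  let L : Submodule ℤ (EuclideanSpace ℝ (Fin 3)) := Submodule.span ℤ (Set.range b)
  let bL : Module.Basis (Fin 3) ℤ L := b.restrictScalars ℤ
  have hrank : Module.finrank ℤ L = 3 := by simp [Module.finrank_eq_card_basis bL]
  have hs : Summable fun z : L => ‖z‖ ^ r :=
    ZLattice.summable_norm_rpow L r (by rw [hrank]; exact_mod_cast hr)
  refine (bL.equivFun.symm.toEquiv.summable_iff.mpr hs).congr fun j => ?_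
  have hz : ((bL.equivFun.symm j : L) : EuclideanSpace ℝ (Fin 3))
      = WithLp.toLp 2 fun i => (j i : ℝ) := by
    rw [Module.Basis.equivFun_symm_apply]
    ext i
    have hb (x : Fin 3) : ((bL x : L) : EuclideanSpace ℝ (Fin 3)) i = if i = x then 1 else 0 := by
      rw [Module.Basis.restrictScalars_apply]
      simp [b, PiLp.single_apply]
    simp [hb]
  have hn : ‖(bL.equivFun.symm j : L)‖ = absFreq j := by
    rw [Submodule.coe_norm, hz, EuclideanSpace.norm_eq, absFreq, normSq]
    simp
  change ‖(bL.equivFun.symm j : L)‖ ^ r = _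
  rw [hn]

/-! ### The truncation operator and its derivative. -/

/-- The amplitude at the frequency `j` of the truncation of a field with amplitude `c`. -/
def truncAmp (η : ℂ → ℂ) (ϱ : ℝ) (j : Freq) (c : Vec) : Vec :=
  (ϱ / absFreq j ^ (9 / 2 : ℝ)) •
    leray j (WithLp.toLp 2 fun i => η ((absFreq j ^ (9 / 2 : ℝ) / ϱ : ℝ) • c i))

/-- The derivative of `truncAmp` at `c` in the direction `d`. -/
def truncAmpDeriv (η : ℂ → ℂ) (ϱ : ℝ) (j : Freq) (c d : Vec) : Vec :=
  (ϱ / absFreq j ^ (9 / 2 : ℝ)) •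
    leray j (WithLp.toLp 2 fun i => fderiv ℝ η ((absFreq j ^ (9 / 2 : ℝ) / ϱ : ℝ) • c i)
      ((absFreq j ^ (9 / 2 : ℝ) / ϱ : ℝ) • d i))

variable {η : ℂ → ℂ} {ϱ : ℝ}

theorem truncAmp_zero_freq (c : Vec) : truncAmp η ϱ 0 c = 0 := by
  simp [truncAmp, leray_zero_freq]

theorem norm_truncAmp_le (hη : IsCutoff η) (hϱ : 0 < ϱ) (j : Freq) (c : Vec) :
    ‖truncAmp η ϱ j c‖ ≤ 6 * ϱ * absFreq j ^ (-(9 / 2) : ℝ) := by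
  have ha : 0 ≤ absFreq j ^ (9 / 2 : ℝ) := Real.rpow_nonneg (absFreq_nonneg j) _
  rw [truncAmp, norm_smul, Real.norm_of_nonneg (by positivity),
    Real.rpow_neg (absFreq_nonneg j)]
  calc _ ≤ ϱ / absFreq j ^ (9 / 2 : ℝ) * (3 * 2) := by
        gcongr
        exact (norm_leray_le _ _).trans (norm_le_of_forall_apply_le fun i => hη.2.2.2 _)
    _ = _ := by ring

/-- The decay exponent `9/2` exceeds the dimension `3`, so the series converges absolutely in `L²`.
-/
theorem summable_truncAmp (hη : IsCutoff η) (hϱ : 0 < ϱ) (w : VecL2) :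
    Summable fun j : Freq => mode j (truncAmp η ϱ j (coeff w j)) :=
  Summable.of_norm_bounded ((summable_absFreq_rpow (r := -(9 / 2)) (by norm_num)).mul_left (6 * ϱ)) fun j => by
    rw [norm_mode]; exact norm_truncAmp_le hη hϱ j _

theorem trunc_eq_tsum (w : VecL2) :
    trunc η ϱ w = ∑' j : Freq, mode j (truncAmp η ϱ j (coeff w j)) := by
  refine tsum_subtype_eq_of_support_subset
    (f := fun j : Freq => mode j (truncAmp η ϱ j (coeff w j))) (s := {j | j ≠ 0}) ?_
  rintro j hj rfl
  exact hj (by simp only [truncAmp_zero_freq, ← modeCLM_apply, map_zero])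

theorem coeff_trunc (hη : IsCutoff η) (hϱ : 0 < ϱ) (w : VecL2) (l : Freq) :
    coeff (trunc η ϱ w) l = truncAmp η ϱ l (coeff w l) := by
  rw [trunc_eq_tsum, ← coeffCLM_apply, (coeffCLM l).map_tsum (summable_truncAmp hη hϱ w),
    tsum_eq_single l fun j hj => by rw [coeffCLM_apply, coeff_mode, if_neg hj.symm],
    coeffCLM_apply, coeff_mode, if_pos rfl]

theorem hasDerivAt_truncAmp (hη : IsCutoff η) (j : Freq) (c d : Vec) :
    HasDerivAt (fun t : ℝ => truncAmp η ϱ j (c + t • d)) (truncAmpDeriv η ϱ j c d) 0 := by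
  set s : ℝ := absFreq j ^ (9 / 2 : ℝ) / ϱ with hs
  have hcoord (i : Fin 3) :
      HasDerivAt (fun t : ℝ => η (s • (c + t • d) i)) (fderiv ℝ η (s • c i) (s • d i)) 0 := by
    have hline : HasDerivAt (fun t : ℝ => s • (c + t • d) i) (s • d i) 0 := by
      have := ((hasDerivAt_id (0 : ℝ)).smul_const (s • d i)).const_add (s • c i)
      refine (this.congr_deriv (one_smul _ _)).congr_of_eventuallyEq (.of_forall fun t => ?_)
      simp
      ring
    have hη' : HasFDerivAt η (fderiv ℝ η (s • c i)) (s • (c + (0 : ℝ) • d) i) := by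
      rw [zero_smul, add_zero]
      exact (hη.1.differentiable (by simp) _).hasFDerivAt
    exact hη'.comp_hasDerivAt 0 hline
  -- Scalars are restricted to `ℝ` because `η` is differentiable only in the real sense.
  let e : (Fin 3 → ℂ) →L[ℝ] Vec :=
    ((lerayCLM j).comp (EuclideanSpace.equiv (Fin 3) ℂ).symm.toContinuousLinearMap).restrictScalars ℝ
  have he := e.hasFDerivAt.comp_hasDerivAt 0 (hasDerivAt_pi.mpr hcoord)
  exact he.const_smul (ϱ / absFreq j ^ (9 / 2 : ℝ))

theorem IsCutoff.exists_norm_fderiv_le (hη : IsCutoff η) : ∃ L, ∀ ξ, ‖fderiv ℝ η ξ‖ ≤ L :=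
  (hη.2.1.fderiv ℝ).exists_bound_of_continuous (hη.1.continuous_fderiv (by simp))

/-- The scaling `|j|^{9/2} / ϱ` inside `η` cancels the prefactor, so the bound is uniform in `j`,
`c` and `ϱ`. -/
theorem norm_truncAmpDeriv_le {L : ℝ} (hL : ∀ ξ, ‖fderiv ℝ η ξ‖ ≤ L) (hϱ : 0 < ϱ) {j : Freq}
    (hj : j ≠ 0) (c d : Vec) : ‖truncAmpDeriv η ϱ j c d‖ ≤ 3 * L * ‖d‖ := by
  have ha : 0 < absFreq j ^ (9 / 2 : ℝ) := Real.rpow_pos_of_pos (absFreq_pos hj) _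
  have hL0 : 0 ≤ L := (norm_nonneg _).trans (hL 0)
  rw [truncAmpDeriv, norm_smul, Real.norm_of_nonneg (by positivity)]
  calc _ ≤ ϱ / absFreq j ^ (9 / 2 : ℝ) * (3 * (L * (absFreq j ^ (9 / 2 : ℝ) / ϱ * ‖d‖))) := by
        gcongr
        refine (norm_leray_le _ _).trans (norm_le_of_forall_apply_le fun i => ?_)
        refine ((fderiv ℝ η _).le_of_opNorm_le (hL _) _).trans ?_
        rw [norm_smul, Real.norm_of_nonneg (by positivity)]
        gcongr
        exact norm_apply_le d i
    _ = _ := by field_simp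

/-- In the direction of a trigonometric polynomial, the truncation operator is differentiable. -/
theorem hasLineDerivAt_trunc (hη : IsCutoff η) (hϱ : 0 < ϱ) (w z : VecL2) (S : Finset Freq)
    (hz : ∀ j ∉ S, coeff z j = 0) :
    HasLineDerivAt ℝ (trunc η ϱ)
      (∑ j ∈ S, mode j (truncAmpDeriv η ϱ j (coeff w j) (coeff z j))) w z := by
  have hsplit (t : ℝ) : trunc η ϱ (w + t • z) = trunc η ϱ w +
      ∑ j ∈ S, (mode j (truncAmp η ϱ j (coeff w j + t • coeff z j)) -
        mode j (truncAmp η ϱ j (coeff w j))) := by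
    rw [← sub_eq_iff_eq_add', trunc_eq_tsum, trunc_eq_tsum,
      ← (summable_truncAmp hη hϱ _).tsum_sub (summable_truncAmp hη hϱ _)]
    simp only [coeff_add, coeff_real_smul]
    -- Outside `S` the increment has no amplitude and the terms cancel; differentiation is then
    -- termwise in a finite sum.
    exact tsum_eq_sum fun j hj => by rw [hz j hj, smul_zero, add_zero, sub_self]
  rw [HasLineDerivAt, funext hsplit]
  refine (HasDerivAt.fun_sum fun j _ => ?_).const_add _
  exact ((((modeCLM j).restrictScalars ℝ).hasFDerivAt.comp_hasDerivAt 0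
    (hasDerivAt_truncAmp hη j (coeff w j) (coeff z j)))).sub_const _

theorem coeff_sum_mode (S : Finset Freq) (c : Freq → Vec) (l : Freq) :
    coeff (∑ j ∈ S, mode j (c j)) l = if l ∈ S then c l else 0 := by
  rw [← coeffCLM_apply, map_sum]
  simp only [coeffCLM_apply, coeff_mode, Finset.sum_ite_eq]

theorem coeff_truncDeriv (hη : IsCutoff η) (hϱ : 0 < ϱ) (w z : VecL2) (S : Finset Freq)
    (hz : ∀ j ∉ S, coeff z j = 0) (l : Freq) :
    coeff (truncDeriv η ϱ w z) l =
      if l ∈ S then truncAmpDeriv η ϱ l (coeff w l) (coeff z l) else 0 := by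
  rw [truncDeriv, (hasLineDerivAt_trunc hη hϱ w z S hz).lineDeriv, coeff_sum_mode]

/-! ### Decay of Fourier coefficients. -/

/-- Fourier coefficients of an element of `H^s` decay like `|j|^{-s}`. -/
theorem exists_norm_coeff_le_of_mem_sobolev {s : ℝ} {v : VecL2} (hv : v ∈ Sobolev s) :
    ∃ K, 0 ≤ K ∧ ∀ j ≠ 0, ‖coeff v j‖ ≤ K * absFreq j ^ (-s) := by
  set T := ∑' j : Freq, absFreq j ^ (2 * s) * ‖coeff v j‖ ^ 2
  refine ⟨√T, Real.sqrt_nonneg _, fun j hj => ?_⟩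
  have hpos : 0 < absFreq j ^ s := Real.rpow_pos_of_pos (absFreq_pos hj) _
  have hle : absFreq j ^ (2 * s) * ‖coeff v j‖ ^ 2 ≤ T :=
    hv.2.le_tsum j fun i _ => mul_nonneg (Real.rpow_nonneg (absFreq_nonneg i) _) (sq_nonneg _)
  rw [Real.rpow_neg (absFreq_nonneg j), ← div_eq_mul_inv, le_div_iff₀ hpos]
  refine Real.le_sqrt_of_sq_le (le_of_eq_of_le ?_ hle)
  rw [mul_comm 2 s, Real.rpow_mul (absFreq_nonneg j), Real.rpow_two]
  ring

theorem coeff_zero_of_mem_H {v : VecL2} (hv : v ∈ H) : coeff v 0 = 0 := by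
  rw [← hv 0, leray_zero_freq]

/-! ### Lattice points on dyadic spheres. -/

/-- The six lattice points of length one. -/
def unitFreqs : Finset Freq :=
  (Fintype.piFinset fun _ : Fin 3 => Finset.Icc (-1 : ℤ) 1).filter fun e => normSq e = 1

theorem sq_apply_le_normSq (j : Freq) (i : Fin 3) : j i ^ 2 ≤ normSq j :=
  Finset.single_le_sum (f := fun i => j i ^ 2) (fun _ _ => sq_nonneg _) (Finset.mem_univ i)

theorem mem_unitFreqs {e : Freq} : e ∈ unitFreqs ↔ normSq e = 1 := by
  simp only [unitFreqs, Finset.mem_filter, Fintype.mem_piFinset, Finset.mem_Icc, and_iff_right_iff_imp]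
  intro h i
  have := sq_apply_le_normSq e i
  exact abs_le.mp (abs_le_one_iff_mul_self_le_one.mpr (by nlinarith))

theorem normSq_zsmul (a : ℤ) (j : Freq) : normSq (a • j) = a ^ 2 * normSq j := by
  simp [normSq, mul_pow, Finset.mul_sum]

/-- A sum of three integral squares is divisible by `4` only if all three integers are even. -/
theorem exists_eq_two_zsmul {j : Freq} (h : 4 ∣ normSq j) : ∃ e : Freq, j = (2 : ℤ) • e := by
  have key (i : Fin 3) : j i ^ 2 % 4 = 0 ∧ j i % 2 = 0 ∨ j i ^ 2 % 4 = 1 := by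
    rcases Int.even_or_odd' (j i) with ⟨a, ha | ha⟩
    · exact .inl ⟨by rw [ha]; ring_nf; omega, by omega⟩
    · exact .inr (by rw [ha]; ring_nf; omega)
  rw [normSq_eq] at h
  have h0 := key 0
  have h1 := key 1
  have h2 := key 2
  have heven : j 0 % 2 = 0 ∧ j 1 % 2 = 0 ∧ j 2 % 2 = 0 := by omega
  refine ⟨fun i => j i / 2, funext fun i => ?_⟩
  fin_cases i <;> simp <;> omega

/-- Descent: halve the point until the radius is one. -/
theorem exists_eq_two_pow_zsmul (m : ℕ) {j : Freq} (h : normSq j = 4 ^ m) :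
    ∃ e ∈ unitFreqs, j = (2 ^ m : ℤ) • e := by
  induction m generalizing j with
  | zero => exact ⟨j, mem_unitFreqs.mpr (by simpa using h), by simp⟩
  | succ m ih =>
    obtain ⟨j', rfl⟩ := exists_eq_two_zsmul (j := j) ⟨4 ^ m, by rw [h]; ring⟩
    obtain ⟨e, he, rfl⟩ := ih (j := j') (by
      rw [normSq_zsmul, pow_succ (4 : ℤ)] at h; linarith)
    exact ⟨e, he, by rw [smul_smul, pow_succ']⟩

/-- The lattice points on the sphere of radius `2 ^ m`. -/
def dyadicSphere (m : ℕ) : Finset Freq := unitFreqs.image ((2 ^ m : ℤ) • ·)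

theorem mem_dyadicSphere {m : ℕ} {j : Freq} : j ∈ dyadicSphere m ↔ normSq j = 4 ^ m := by
  rw [dyadicSphere, Finset.mem_image]
  constructor
  · rintro ⟨e, he, rfl⟩
    rw [normSq_zsmul, mem_unitFreqs.mp he, mul_one, ← pow_mul, mul_comm, pow_mul]
    norm_num
  · intro h
    obtain ⟨e, he, rfl⟩ := exists_eq_two_pow_zsmul m h
    exact ⟨e, he, rfl⟩

theorem card_dyadicSphere_le (m : ℕ) : (dyadicSphere m).card ≤ unitFreqs.card :=
  Finset.card_image_le

theorem absFreq_of_mem_dyadicSphere {m : ℕ} {j : Freq} (hj : j ∈ dyadicSphere m) :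
    absFreq j = 2 ^ m := by
  rw [absFreq, mem_dyadicSphere.mp hj, Real.sqrt_eq_iff_mul_self_eq (by positivity) (by positivity)]
  push_cast
  rw [← mul_pow]
  norm_num

theorem ne_zero_of_mem_dyadicSphere {m : ℕ} {j : Freq} (hj : j ∈ dyadicSphere m) : j ≠ 0 := by
  rintro rfl
  have := mem_dyadicSphere.mp hj
  rw [normSq_eq_zero.mpr rfl] at this
  exact (pow_pos (by norm_num : (0 : ℤ) < 4) m).ne this

/-- Distinct lattice points on the sphere of radius `2 ^ m` have distance at least `2 ^ m`. -/
theorem two_pow_le_absFreq_sub {m : ℕ} {j l : Freq} (hj : j ∈ dyadicSphere m)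
    (hl : l ∈ dyadicSphere m) (hjl : j ≠ l) : 2 ^ m ≤ absFreq (j - l) := by
  obtain ⟨d, -, rfl⟩ := Finset.mem_image.mp hj
  obtain ⟨e, -, rfl⟩ := Finset.mem_image.mp hl
  refine Real.le_sqrt_of_sq_le ?_
  rw [← smul_sub, normSq_zsmul]
  have hde : d - e ≠ 0 := fun h => hjl (by rw [sub_eq_zero.mp h])
  have : (1 : ℝ) ≤ normSq (d - e) := by exact_mod_cast normSq_pos hde
  push_cast
  nlinarith [sq_nonneg ((2 : ℝ) ^ m)]

/-! ### Eigenvalues and spectral projectors of the Stokes operator. -/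

theorem finite_normSq_le (n : ℕ) : {j : Freq | j ≠ 0 ∧ normSq j ≤ n}.Finite := by
  refine (Set.Finite.pi' fun _ : Fin 3 => Set.finite_Icc (-n : ℤ) n).subset fun j hj i => ?_
  have h := (sq_apply_le_normSq j i).trans hj.2
  exact abs_le.mp ((Int.natAbs_le_self_sq (j i) |>.trans' (by simp)).trans h)

/-- If `n` is a value of `|j|²`, `j ≠ 0`, it is the last eigenvalue counted by `stokesCount n`. -/
theorem stokesEigenvalue_stokesCount {n : ℕ} {j : Freq} (hj : j ≠ 0) (hn : normSq j = n) :
    stokesEigenvalue (stokesCount n) = n := by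
  refine le_antisymm (Nat.sInf_le (le_refl (stokesCount n))) (le_csInf ⟨n, le_refl (stokesCount n)⟩ fun m hm => ?_)
  by_contra! hmn
  have hlt : {i : Freq | i ≠ 0 ∧ normSq i ≤ m} ⊂ {i : Freq | i ≠ 0 ∧ normSq i ≤ n} := by
    refine ⟨fun i hi => ⟨hi.1, hi.2.trans (by exact_mod_cast hmn.le)⟩, fun h => ?_⟩
    have := (h (show j ∈ _ from ⟨hj, hn.le⟩)).2
    omega
  -- Finiteness is essential: `Set.ncard` is `0` on infinite sets.
  have := Set.ncard_lt_ncard hlt (finite_normSq_le n)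
  change 2 * Set.ncard {i : Freq | i ≠ 0 ∧ normSq i ≤ n} ≤
    2 * Set.ncard {i : Freq | i ≠ 0 ∧ normSq i ≤ m} at hm
  omega

theorem one_le_stokesCount {n : ℕ} {j : Freq} (hj : j ≠ 0) (hn : normSq j ≤ n) :
    1 ≤ stokesCount n := by
  have : 0 < Set.ncard {i : Freq | i ≠ 0 ∧ normSq i ≤ n} :=
    (Set.ncard_pos (finite_normSq_le n)).mpr ⟨j, hj, hn⟩
  change 1 ≤ 2 * Set.ncard {i : Freq | i ≠ 0 ∧ normSq i ≤ n}
  omega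

theorem exists_mem_dyadicSphere (m : ℕ) : ∃ j, j ∈ dyadicSphere m :=
  ⟨![2 ^ m, 0, 0], mem_dyadicSphere.mpr (by
    simp only [normSq_eq, Matrix.cons_val_zero, Matrix.cons_val_one, Matrix.cons_val]
    rw [← pow_mul, mul_comm, pow_mul]
    norm_num)⟩

/-- The spectral projector onto an eigenvalue `4 ^ m` of the Stokes operator. -/
theorem specProj_half {m N : ℕ} (hN : stokesEigenvalue N = 4 ^ m) (a : FourierSeries) :
    specProj (1 / 2) N a = ∑ j ∈ dyadicSphere m, mode j (leray j (a j)) := by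
  have hset : {j : Freq | j ≠ 0 ∧ (stokesEigenvalue N : ℝ) - 1 / 2 ≤ normSq j ∧
      (normSq j : ℝ) ≤ stokesEigenvalue N + 1 / 2} = dyadicSphere m := by
    ext j
    rw [hN, Finset.mem_coe]
    constructor
    · rintro ⟨-, h1, h2⟩
      -- `|j|²` is an integer within `1/2` of `4 ^ m`, hence equal to it.
      refine mem_dyadicSphere.mpr (le_antisymm (Int.lt_add_one_iff.mp ?_) (Int.le_of_sub_one_lt ?_))
      · have : (normSq j : ℝ) < 4 ^ m + 1 := by push_cast at h2; linarith
        exact_mod_cast this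
      · have : (4 : ℝ) ^ m - 1 < normSq j := by push_cast at h1; linarith
        exact_mod_cast this
    · intro hj
      refine ⟨ne_zero_of_mem_dyadicSphere hj, ?_⟩
      rw [mem_dyadicSphere.mp hj]
      push_cast
      constructor <;> linarith
  refine Eq.trans ?_ (Finset.tsum_subtype' (dyadicSphere m) fun j => mode j (leray j (a j)))
  rw [← hset]
  rfl

/-! ### Matrix entries of the linearised nonlinearity. -/

theorem norm_transport_le {l : Freq} {R : ℝ} (hl : ∀ i, |(l i : ℝ)| ≤ R) (a b : Vec) :
    ‖(Complex.I * ∑ i, a i * (l i : ℂ)) • b‖ ≤ 3 * R * ‖a‖ * ‖b‖ := by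
  have h : ‖∑ i, a i * (l i : ℂ)‖ ≤ 3 * R * ‖a‖ := by
    calc ‖∑ i, a i * (l i : ℂ)‖ ≤ ∑ _i : Fin 3, ‖a‖ * R := by
          refine norm_sum_le_of_le _ fun i _ => ?_
          rw [norm_mul, Complex.norm_intCast]
          exact mul_le_mul (norm_apply_le a i) (hl i) (abs_nonneg _) (norm_nonneg _)
      _ = 3 * R * ‖a‖ := by simp; ring
  rw [norm_smul, norm_mul, Complex.norm_I, one_mul]
  gcongr

theorem norm_bilin_le_of_left {S : Finset Freq} {y u : FourierSeries} (hy : ∀ l ∉ S, y l = 0)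
    {R Y U : ℝ} (hR : ∀ l ∈ S, ∀ i, |(l i : ℝ)| ≤ R) (hY : ∀ l, ‖y l‖ ≤ Y) {j : Freq} (hj : j ∈ S)
    (hU : ∀ l ∈ S, ‖u (j - l)‖ ≤ U) : ‖bilin y u j‖ ≤ S.card * (6 * R * Y * U) := by
  have hR0 : 0 ≤ R := (abs_nonneg _).trans (hR j hj 0)
  have hY0 : 0 ≤ Y := (norm_nonneg _).trans (hY 0)
  refine (norm_leray_le _ _).trans ?_
  -- The substitution `l ↦ j - l` puts the summation variable on `y`, leaving a finite sum. The
  -- gradient now falls on `u` at `j - l`, whose components are at most `2 * R`; hence `6` here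
  -- against `3` in `norm_bilin_le_of_right`.
  rw [← (Equiv.subLeft j).tsum_eq]
  simp only [Equiv.subLeft_apply, sub_sub_cancel]
  rw [tsum_eq_sum (s := S) fun l hl => by simp [hy l hl], ← nsmul_eq_mul]
  refine norm_sum_le_of_le _ (fun l hl => ?_) |>.trans (Finset.sum_const _).le
  have hjl (i : Fin 3) : |((j - l) i : ℝ)| ≤ 2 * R := by
    rw [Pi.sub_apply, Int.cast_sub]
    exact (abs_sub _ _).trans (by linarith [hR j hj i, hR l hl i])
  calc _ ≤ 3 * (2 * R) * ‖y l‖ * ‖u (j - l)‖ := norm_transport_le hjl _ _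
    _ ≤ 3 * (2 * R) * Y * U := by gcongr; exacts [hY l, hU l hl]
    _ = _ := by ring

theorem norm_bilin_le_of_right {S : Finset Freq} {y u : FourierSeries} (hy : ∀ l ∉ S, y l = 0)
    {R Y U : ℝ} (hR : ∀ l ∈ S, ∀ i, |(l i : ℝ)| ≤ R) (hY : ∀ l, ‖y l‖ ≤ Y) {j : Freq} (hj : j ∈ S)
    (hU : ∀ l ∈ S, ‖u (j - l)‖ ≤ U) : ‖bilin u y j‖ ≤ S.card * (3 * R * Y * U) := by
  have hR0 : 0 ≤ R := (abs_nonneg _).trans (hR j hj 0)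
  refine (norm_leray_le _ _).trans ?_
  rw [tsum_eq_sum (s := S) fun l hl => by rw [hy l hl, smul_zero], ← nsmul_eq_mul]
  refine norm_sum_le_of_le _ (fun l hl => ?_) |>.trans (Finset.sum_const _).le
  have hU0 : 0 ≤ U := (norm_nonneg _).trans (hU l hl)
  calc _ ≤ 3 * R * ‖u (j - l)‖ * ‖y l‖ := norm_transport_le (hR l hl) _ _
    _ ≤ 3 * R * U * Y := by gcongr; exacts [hU l hl, hY l]
    _ = _ := by ring

/-- `W(w) + v` has zero mean, and its coefficients decay like `|j|^{-5/4}`, uniformly in `w`. -/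
theorem exists_norm_coeff_trunc_add_le (hη : IsCutoff η) (hϱ : 0 < ϱ) {v : VecL2}
    (hv : v ∈ Sobolev (5 / 4)) : ∃ K, 0 ≤ K ∧ ∀ w, coeff (trunc η ϱ w + v) 0 = 0 ∧
      ∀ j ≠ 0, ‖coeff (trunc η ϱ w + v) j‖ ≤ K * absFreq j ^ (-(5 / 4) : ℝ) := by
  obtain ⟨K, hK, hvK⟩ := exists_norm_coeff_le_of_mem_sobolev hv
  refine ⟨6 * ϱ + K, by positivity, fun w => ⟨?_, fun j hj => ?_⟩⟩
  · rw [coeff_add, coeff_trunc hη hϱ, truncAmp_zero_freq, coeff_zero_of_mem_H hv.1, add_zero]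
  · rw [coeff_add, coeff_trunc hη hϱ, add_mul]
    refine (norm_add_le _ _).trans (add_le_add ((norm_truncAmp_le hη hϱ j _).trans ?_) (hvK j hj))
    exact mul_le_mul_of_nonneg_left
      (Real.rpow_le_rpow_of_exponent_le (one_le_absFreq hj) (by norm_num)) (by positivity)

theorem norm_sum_mode_leray_le {S : Finset Freq} {a : FourierSeries} {M : ℝ}
    (ha : ∀ j ∈ S, ‖a j‖ ≤ M) : ‖∑ j ∈ S, mode j (leray j (a j))‖ ≤ S.card * M := by
  rw [← nsmul_eq_mul]
  exact (norm_sum_le _ _).trans (Finset.sum_le_card_nsmul _ _ _ fun j hj =>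
    ((norm_mode _ _).trans_le (norm_leray_le _ _)).trans (ha j hj))

/-- Matrix entries of `F₃'(W(w))` at frequencies of length `r` and of mutual distance at least `r`:
the nonlinearity costs `r`, the coefficients of `W(w) + v` gain `r^{-5/4}`, and `A^{-1/4}` gains
`r^{-1/2}`. -/
theorem exists_norm_nonlinDeriv_le (hη : IsCutoff η) (hϱ : 0 < ϱ) {v : VecL2}
    (hv : v ∈ Sobolev (5 / 4)) :
    ∃ C, 0 ≤ C ∧ ∀ (S : Finset Freq) (r : ℝ), 0 < r → (∀ l ∈ S, absFreq l = r) →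
      (∀ j ∈ S, ∀ l ∈ S, j ≠ l → r ≤ absFreq (j - l)) →
      ∀ w z : VecL2, (∀ l ∉ S, coeff z l = 0) → ∀ Z, (∀ l, ‖coeff z l‖ ≤ Z) →
      ∀ j ∈ S, ‖nonlinDeriv η ϱ v w z j‖ ≤ S.card * (C * r ^ (-(3 / 4) : ℝ) * Z) := by
  obtain ⟨K, hK, huK⟩ := exists_norm_coeff_trunc_add_le hη hϱ hv
  obtain ⟨L, hL⟩ := hη.exists_norm_fderiv_le
  have hL0 : 0 ≤ L := (norm_nonneg _).trans (hL 0)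
  -- `27 = (6 + 3) * 3`: the two bilinear bounds, times the factor `3 * L` from `W'(w)`.
  refine ⟨27 * L * K, by positivity, fun S r hr0 hS hsep w z hz Z hZ j hj => ?_⟩
  set y := coeff (truncDeriv η ϱ w z)
  set u := coeff (trunc η ϱ w + v) with hu
  set U : ℝ := K * r ^ (-(5 / 4) : ℝ) with hU
  have hycoeff (l : Freq) :
      y l = if l ∈ S then truncAmpDeriv η ϱ l (coeff w l) (coeff z l) else 0 :=
    coeff_truncDeriv hη hϱ w z S hz l
  have hyS : ∀ l ∉ S, y l = 0 := fun l hl => by rw [hycoeff, if_neg hl]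
  have hS0 : ∀ l ∈ S, l ≠ 0 := by
    rintro l hl rfl
    have := hS 0 hl
    rw [absFreq, normSq_eq_zero.mpr rfl, Int.cast_zero, Real.sqrt_zero] at this
    exact hr0.ne this
  have hyY (l : Freq) : ‖y l‖ ≤ 3 * L * Z := by
    by_cases hl : l ∈ S
    · rw [hycoeff, if_pos hl]
      refine (norm_truncAmpDeriv_le hL hϱ (hS0 l hl) _ _).trans ?_
      exact mul_le_mul_of_nonneg_left (hZ l) (by positivity)
    · rw [hyS l hl, norm_zero]
      exact mul_nonneg (by positivity) ((norm_nonneg _).trans (hZ 0))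
  have hSr : ∀ l ∈ S, ∀ i, |(l i : ℝ)| ≤ r := fun l hl i =>
    (abs_apply_le_absFreq l i).trans (hS l hl).le
  have huU : ∀ l ∈ S, ‖u (j - l)‖ ≤ U := fun l hl => by
    rcases eq_or_ne j l with rfl | hjl
    · rw [sub_self, hu, (huK w).1, norm_zero]; positivity
    · refine ((huK w).2 _ (sub_ne_zero.mpr hjl)).trans ?_
      exact mul_le_mul_of_nonneg_left (Real.rpow_le_rpow_of_nonpos hr0
        (hsep j hj l hl hjl) (by norm_num)) hK
  have hpow : r ^ (-(1 / 2) : ℝ) * (r * r ^ (-(5 / 4) : ℝ)) = r ^ (-(3 / 4) : ℝ) := by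
    nth_rw 2 [← Real.rpow_one r]
    rw [← Real.rpow_add hr0, ← Real.rpow_add hr0]
    norm_num
  have h1 := norm_bilin_le_of_left hyS hSr hyY hj huU
  have h2 := norm_bilin_le_of_right hyS hSr hyY hj huU
  change ‖absFreq j ^ (2 * -(1 / 4) : ℝ) • (bilin y u j + bilin u y j)‖ ≤ _
  rw [norm_smul, Real.norm_of_nonneg (Real.rpow_nonneg (absFreq_nonneg j) _), hS j hj,
    show (2 * -(1 / 4) : ℝ) = -(1 / 2) by norm_num]
  calc _ ≤ r ^ (-(1 / 2) : ℝ) * (S.card * (9 * r * (3 * L * Z) * U)) := by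
        gcongr
        exact (norm_add_le _ _).trans ((add_le_add h1 h2).trans_eq (by ring))
    _ = _ := by rw [← hpow, hU]; ring

/-- The compression of `F₃'(W(w))` to the sphere of radius `2 ^ m` has norm `O(2 ^ (-3m/4))`. -/
theorem exists_norm_compression_le (hη : IsCutoff η) (hϱ : 0 < ϱ) {v : VecL2}
    (hv : v ∈ Sobolev (5 / 4)) :
    ∃ C : ℝ, ∀ m N : ℕ, stokesEigenvalue N = 4 ^ m → ∀ w z : VecL2,
      ‖specProj (1 / 2) N (nonlinDeriv η ϱ v w (specProj (1 / 2) N (coeff z)))‖ ≤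
        C * ((2 : ℝ) ^ m) ^ (-(3 / 4) : ℝ) * ‖z‖ := by
  obtain ⟨C, hC, hF⟩ := exists_norm_nonlinDeriv_le hη hϱ hv
  -- One cardinality comes from summing over input frequencies, the other from output frequencies;
  -- both are bounded independently of `m`.
  refine ⟨unitFreqs.card ^ 2 * C, fun m N hN w z => ?_⟩
  have hz (l : Freq) : coeff (specProj (1 / 2) N (coeff z)) l =
      if l ∈ dyadicSphere m then leray l (coeff z l) else 0 := by
    rw [specProj_half hN, coeff_sum_mode]
  have hzZ (l : Freq) : ‖coeff (specProj (1 / 2) N (coeff z)) l‖ ≤ ‖z‖ := by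
    rw [hz]
    split_ifs
    · exact (norm_leray_le _ _).trans (norm_coeff_le _ _)
    · simp
  have hentry := hF (dyadicSphere m) (2 ^ m) (by positivity)
    (fun _ => absFreq_of_mem_dyadicSphere) (fun _ hj _ hl => two_pow_le_absFreq_sub hj hl) w _
    (fun l hl => by rw [hz, if_neg hl]) ‖z‖ hzZ
  rw [specProj_half hN (nonlinDeriv _ _ _ _ _)]
  refine (norm_sum_mode_leray_le hentry).trans ?_
  have hcard : ((dyadicSphere m).card : ℝ) ≤ unitFreqs.card :=
    Nat.cast_le.mpr (card_dyadicSphere_le m)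
  have hcard0 : (0 : ℝ) ≤ (dyadicSphere m).card := Nat.cast_nonneg _
  generalize ((dyadicSphere m).card : ℝ) = s at hcard hcard0 ⊢
  generalize (unitFreqs.card : ℝ) = q at hcard ⊢
  have hq0 := hcard0.trans hcard
  calc s * (s * (C * ((2 : ℝ) ^ m) ^ (-(3 / 4) : ℝ) * ‖z‖))
      ≤ q * (q * (C * ((2 : ℝ) ^ m) ^ (-(3 / 4) : ℝ) * ‖z‖)) := by gcongr
    _ = _ := by ring

end HyperNS

end

theorem theorem5p13
    (ν : ℝ) (hν : 0 < ν)
    (f v : HyperNS.VecL2) (hf : f ∈ HyperNS.H) (hv : HyperNS.IsStationarySolution ν f v)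
    (η : ℂ → ℂ) (hη : HyperNS.IsCutoff η)
    (ϱ : ℝ) (hϱ : 0 < ϱ)
    (δ : ℝ) (hδ : 0 < δ) :
    ∃ N : ℕ, 1 ≤ N ∧ ∃ k : ℝ, 0 < k ∧ k < HyperNS.stokesEigenvalue N ∧
      ∀ w ∈ HyperNS.H, ∀ z ∈ HyperNS.H,
        ‖HyperNS.specProj k N (HyperNS.nonlinDeriv η ϱ v w
            (HyperNS.specProj k N (HyperNS.coeff z)))‖ ≤ δ * ‖z‖ := by
  obtain ⟨C, hCm⟩ := HyperNS.exists_norm_compression_le hη hϱ hv.1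
  have hlim : Filter.Tendsto (fun m : ℕ => C * ((2 : ℝ) ^ m) ^ (-(3 / 4) : ℝ))
      Filter.atTop (nhds 0) := by
    have := ((tendsto_rpow_neg_atTop (by norm_num : (0 : ℝ) < 3 / 4)).comp
      (tendsto_pow_atTop_atTop_of_one_lt (one_lt_two (α := ℝ)))).const_mul C
    rwa [mul_zero] at this
  obtain ⟨m, hm⟩ := (hlim.eventually_lt_const hδ).exists
  obtain ⟨j, hj⟩ := HyperNS.exists_mem_dyadicSphere m
  have hj0 := HyperNS.ne_zero_of_mem_dyadicSphere hj
  have hjn : HyperNS.normSq j = (4 ^ m : ℕ) := by exact_mod_cast HyperNS.mem_dyadicSphere.mp hj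
  have hN := HyperNS.stokesEigenvalue_stokesCount hj0 hjn
  -- The witness is `N = stokesCount (4 ^ m)`; `k = 1/2` is below `4 ^ m` even for `m = 0`.
  refine ⟨_, HyperNS.one_le_stokesCount hj0 hjn.le, 1 / 2, by norm_num, ?_, fun w _ z _ =>
    (hCm m _ hN w z).trans (mul_le_mul_of_nonneg_right hm.le (norm_nonneg z))⟩
  rw [hN]
  push_cast
  exact lt_of_lt_of_le (by norm_num) (one_le_pow₀ (by norm_num))
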